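/- Let $m,n$ be positive integers, $H_A=\mathbb C^m$, $H_B=\mathbb C^n$. For a density matrix $\sigma$ put, if $m$ is even, $$f_m(\sigma)=1-\sum_{i=1}^{m/2}\Big[\frac{4i}{m^2+2m}\operatorname{Tr}(\sigma^i)+\frac{2m-4i+4}{m^2+2m}\operatorname{Tr}(\sigma^{i+\frac m2})\Big],$$ and, if $m$ is odd, $$f_m(\sigma)=1-\sum_{i=1}^{(m-1)/2}\Big[\frac{4i}{(m+1)^2}\operatorname{Tr}(\sigma^i)+\frac{2m-4i+2}{(m+1)^2}\operatorname{Tr}(\sigma^{\frac{m+1}2+i})\Big]-\frac{2}{m+1}\operatorname{Tr}(\sigma^{\frac{m+1}{2}}).$$ For a unit vector $\psi\in H_A\otimes H_B$ let $E^{rm}(\psi)=f_m(\rho_A)$ with $\rho_A=\operatorname{Tr}_B|\psi\rangle\langle\psi|$, and for a state (density matrix) $\rho$ on $H_A\otimes H_B$ let $$E^{rm}(\rho)=\min\sum_i p_iE^{rm}(\psi_i)$$ over all finite decompositions $\rho=\sum_ip_i|\psi_i\rangle\langle\psi_i|$ with $p_i\ge 0$, $\sum_ip_i=1$ and unit vectors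 $\psi_i$. Then $E^{rm}$ is a well-defined entanglement measure: (0) the minimum is attained for every state $\rho$, and $E^{rm}(|\psi\rangle\langle\psi|)=E^{rm}(\psi)$ for every unit vector $\psi$; (i) $E^{rm}(\rho)\ge 0$ for every state $\rho$, and $E^{rm}(\rho)=0$ if $\rho$ is separable (a finite convex combination of product states); (ii) $E^{rm}((U\otimes V)\rho(U\otimes V)^\dagger)=E^{rm}(\rho)$ for every state $\rho$ and all unitaries $U$ on $H_A$, $V$ on $H_B$; (iii) $E^{rm}$ does not increase on average under stochastic LOCC: if a finite-round protocol of local operations (local quantum instruments: finitely many completely positive maps with trace-preserving sum) and classical communication, with intermediate local systems of arbitrary finite dimensions and with output system $\mathbb C^m\otimes\mathbb C^{n'}$ ($n'$ arbitrary, in particular $n'=n$), has the finitely many classical outcomes $c$ with unnormalized conditional operations $\varepsilon_c$, then for every state $\rho$ on $H_A\otimes H_B$ $$\sum_{c:\,\pi_c>0}\pi_c\,E^{rm}\big(\varepsilon_c(\rho)/\pi_c\big)\le E^{rm}(\rho),\qquad \pi_c=\operatorname{Tr}\varepsilon_c(\rho);$$ (iv) $E^{rm}$ is convex on the set of states on $H_A\otimes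 H_B$; (v) $E^{rm}(\Lambda(\rho))\le E^{rm}(\rho)$ for every state $\rho$ on $H_A\otimes H_B$ and every LOCC map $\Lambda=\sum_c\varepsilon_c$ of this kind. -/

import Mathlib

open scoped Matrix Kronecker BigOperators ComplexOrder

noncomputable section

namespace MomentEntanglement

/-- Linear maps from `a × a` complex matrices to `a' × a'` complex matrices. -/
abbrev SuperOp (a a' : Type) : Type :=
  Matrix a a ℂ →ₗ[ℂ] Matrix a' a' ℂ

/-- A density matrix: positive semidefinite with trace one. -/
def IsState {a : Type} [Fintype a] (ρ : Matrix a a ℂ) : Prop :=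
  ρ.PosSemidef ∧ ρ.trace = 1

/-- A unit vector. -/
def IsUnitVec {a : Type} [Fintype a] (ψ : a → ℂ) : Prop :=
  star ψ ⬝ᵥ ψ = 1

/-- The rank-one operator `|ψ⟩⟨ψ|`. -/
def ketbra {a : Type} (ψ : a → ℂ) : Matrix a a ℂ :=
  Matrix.vecMulVec ψ (star ψ)

/-- The partial trace over the second factor. -/
def partialTraceB {a b : Type} [Fintype b] (ρ : Matrix (a × b) (a × b) ℂ) : Matrix a a ℂ :=
  Matrix.of fun i i' => ∑ j, ρ (i, j) (i', j)

/-- The `k`-th moment `Tr (ρ ^ k)` (a real number when `ρ` is Hermitian). -/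
def moment {a : Type} [Fintype a] [DecidableEq a] (k : ℕ) (ρ : Matrix a a ℂ) : ℝ :=
  (ρ ^ k).trace.re

/-- The linear combination of moments with parameter `m`. -/
def momentFn {a : Type} [Fintype a] [DecidableEq a] (m : ℕ) (ρ : Matrix a a ℂ) : ℝ :=
  if Even m then
    1 - ∑ i ∈ Finset.Icc 1 (m / 2),
      ((4 * i : ℝ) / ((m : ℝ) ^ 2 + 2 * m) * moment i ρ
        + (2 * m - 4 * i + 4 : ℝ) / ((m : ℝ) ^ 2 + 2 * m) * moment (i + m / 2) ρ)
  else
    1 - ∑ i ∈ Finset.Icc 1 ((m - 1) / 2),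
      ((4 * i : ℝ) / ((m : ℝ) + 1) ^ 2 * moment i ρ
        + (2 * m - 4 * i + 2 : ℝ) / ((m : ℝ) + 1) ^ 2 * moment ((m + 1) / 2 + i) ρ)
      - 2 / ((m : ℝ) + 1) * moment ((m + 1) / 2) ρ

/-- `E^{rm}` of a pure state vector `ψ ∈ ℂ^m ⊗ ℂ^n`: the combination, with parameter `m`, of the
moments of the reduced state on the first factor. -/
def pureErm {m n : ℕ} (ψ : Fin m × Fin n → ℂ) : ℝ :=
  momentFn m (partialTraceB (ketbra ψ))

/-- `(p, ψ)` is a finite ensemble of pure states with average `ρ`. -/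
def IsPureDecomposition {a : Type} [Fintype a] {k : ℕ} (p : Fin k → ℝ) (ψ : Fin k → a → ℂ)
    (ρ : Matrix a a ℂ) : Prop :=
  (∀ i, 0 ≤ p i) ∧ ∑ i, p i = 1 ∧ (∀ i, IsUnitVec (ψ i)) ∧ ρ = ∑ i, p i • ketbra (ψ i)

/-- The averages of `E^{rm}` over all pure state decompositions of `ρ`. -/
def decompositionValues {m n : ℕ} (ρ : Matrix (Fin m × Fin n) (Fin m × Fin n) ℂ) : Set ℝ :=
  {x | ∃ (k : ℕ) (p : Fin k → ℝ) (ψ : Fin k → Fin m × Fin n → ℂ),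
    IsPureDecomposition p ψ ρ ∧ x = ∑ i, p i * pureErm (ψ i)}

/-- `E^{rm}` of a state on `ℂ^m ⊗ ℂ^n`, by convex roof. -/
def Erm {m n : ℕ} (ρ : Matrix (Fin m × Fin n) (Fin m × Fin n) ℂ) : ℝ :=
  sInf (decompositionValues ρ)

/-- Separable states: finite convex combinations of product states. -/
def IsSeparable {a b : Type} [Fintype a] [Fintype b] (ρ : Matrix (a × b) (a × b) ℂ) : Prop :=
  ∃ (k : ℕ) (p : Fin k → ℝ) (σ : Fin k → Matrix a a ℂ) (τ : Fin k → Matrix b b ℂ),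
    (∀ i, 0 ≤ p i) ∧ ∑ i, p i = 1 ∧ (∀ i, IsState (σ i)) ∧ (∀ i, IsState (τ i)) ∧
      ρ = ∑ i, p i • (σ i ⊗ₖ τ i)

/-- `Φ ⊗ id`: the map `Φ` applied to the first factor. -/
def onA {a a' : Type} (b : Type) (Φ : SuperOp a a') : SuperOp (a × b) (a' × b) where
  toFun X := Matrix.of fun x y => Φ (Matrix.of fun u v => X (u, x.2) (v, y.2)) x.1 y.1
  map_add' X Y := by
    ext x y
    exact congrFun (congrFun (map_add Φ (Matrix.of fun u v => X (u, x.2) (v, y.2))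
      (Matrix.of fun u v => Y (u, x.2) (v, y.2))) x.1) y.1
  map_smul' c X := by
    ext x y
    exact congrFun (congrFun (map_smul Φ c (Matrix.of fun u v => X (u, x.2) (v, y.2))) x.1) y.1

/-- `id ⊗ Φ`: the map `Φ` applied to the second factor. -/
def onB (a : Type) {b b' : Type} (Φ : SuperOp b b') : SuperOp (a × b) (a × b') where
  toFun X := Matrix.of fun x y => Φ (Matrix.of fun u v => X (x.1, u) (y.1, v)) x.2 y.2
  map_add' X Y := by
    ext x y
    exact congrFun (congrFun (map_add Φ (Matrix.of fun u v => X (x.1, u) (y.1, v))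
      (Matrix.of fun u v => Y (x.1, u) (y.1, v))) x.2) y.2
  map_smul' c X := by
    ext x y
    exact congrFun (congrFun (map_smul Φ c (Matrix.of fun u v => X (x.1, u) (y.1, v))) x.2) y.2

/-- Complete positivity: `id_k ⊗ Φ` preserves positive semidefiniteness for every `k`. -/
def IsCP {a a' : Type} [Fintype a] [Fintype a'] (Φ : SuperOp a a') : Prop :=
  ∀ (k : ℕ) (X : Matrix (Fin k × a) (Fin k × a) ℂ),
    X.PosSemidef → (onB (Fin k) Φ X).PosSemidef

/-- A quantum instrument on a `d`-dimensional system with `r` outcomes: completely positive maps,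
the sum of which preserves the trace. The output dimension may depend on the outcome. -/
def IsInstrument {d r : ℕ} {e : Fin r → ℕ} (Φ : ∀ j, SuperOp (Fin d) (Fin (e j))) : Prop :=
  (∀ j, IsCP (Φ j)) ∧ ∀ X, ∑ j, (Φ j X).trace = X.trace

/-- `IsLOCC F`: the family `F` of (unnormalized) conditional operations, indexed by a classical
outcome `c : Fin K`, is implemented by a finite protocol of local operations and classical
communication from `ℂ^m ⊗ ℂ^n` to `ℂ^m' ⊗ ℂ^n'`. A protocol either stops and announces an outcome,
or one party applies a local instrument, its result is communicated, and a protocol depending on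
this result is performed. Different histories may announce the same outcome (coarse-graining), and
intermediate local dimensions are arbitrary (local ancillas may be added or discarded). -/
inductive IsLOCC {K m' n' : ℕ} : ∀ {m n : ℕ},
    (Fin K → SuperOp (Fin m × Fin n) (Fin m' × Fin n')) → Prop
  | halt (c : Fin K) : IsLOCC (Pi.single c LinearMap.id)
  | alice {m n r : ℕ} {e : Fin r → ℕ} (Φ : ∀ j, SuperOp (Fin m) (Fin (e j)))
      (F : ∀ j, Fin K → SuperOp (Fin (e j) × Fin n) (Fin m' × Fin n'))
      (hΦ : IsInstrument Φ) (hF : ∀ j, IsLOCC (F j)) :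
      IsLOCC (fun c => ∑ j, F j c ∘ₗ onA (Fin n) (Φ j))
  | bob {m n r : ℕ} {e : Fin r → ℕ} (Φ : ∀ j, SuperOp (Fin n) (Fin (e j)))
      (F : ∀ j, Fin K → SuperOp (Fin m × Fin (e j)) (Fin m' × Fin n'))
      (hΦ : IsInstrument Φ) (hF : ∀ j, IsLOCC (F j)) :
      IsLOCC (fun c => ∑ j, F j c ∘ₗ onB (Fin m) (Φ j))

/-- An LOCC map: the total operation of an LOCC protocol, its outcome being ignored. -/
def IsLOCCMap {m n m' n' : ℕ} (Λ : SuperOp (Fin m × Fin n) (Fin m' × Fin n')) : Prop :=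
  ∃ (K : ℕ) (F : Fin K → SuperOp (Fin m × Fin n) (Fin m' × Fin n')),
    IsLOCC F ∧ Λ = ∑ c, F c

/-- The probability of the outcome described by the operation `G`, on input `ρ`. -/
def outcomeProb {a a' : Type} [Fintype a'] (G : SuperOp a a') (ρ : Matrix a a ℂ) : ℝ :=
  (G ρ).trace.re

/-- The normalized output (meaningful if the probability of the outcome is not zero). -/
def outcomeState {a a' : Type} [Fintype a'] (G : SuperOp a a') (ρ : Matrix a a ℂ) :
    Matrix a' a' ℂ :=
  (outcomeProb G ρ)⁻¹ • G ρ

end MomentEntanglement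

end

/-! Up to the constant 1, the function `momentFn M` is minus a weighted mean of the moments `Tr
σ^k`, `k ≥ 1`: for `M ≠ 0` the weights are nonnegative with sum 1. Moments are convex, so `momentFn`
is concave, and it vanishes on pure states.

Its degree-one homogeneous extension `homMomentFn` to positive semidefinite matrices is therefore
superadditive (`sum_homMomentFn_le`), zero on rank-one matrices and nonnegative. The convex roof can
then be computed over decompositions into unnormalized vectors; the resulting sets `roofSums` add
and scale with the matrix, which removes all division by probabilities. Convexity and vanishing on
separable states follow at once.

For monotonicity, let one party measure a pure state. Trace preservation makes the reduced states of
the resulting vectors sum to the other party's original reduced state, so superadditivity bounds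
their total by the initial value. Both reduced states of a pure vector have equal moments, so it
does not matter who measures. Induction on the protocol gives `IsLOCC.exists_roofSums`; the
parameter `M` stays fixed while local dimensions change.

The minimum is attained because the set of values is a slice of a compact convex hull, projected to
`ℝ`. -/

namespace MomentEntanglement

/-! ### Weights of the moment combination and convexity of moments. -/

section Moments

variable {a : Type} [Fintype a] [DecidableEq a]

/-- The combination of moments is `1` minus a nonnegative combination of moments of positive
order. -/
theorem exists_momentFn_eq (M : ℕ) :
    ∃ (ι : Type) (s : Finset ι) (w : ι → ℝ) (k : ι → ℕ),
      (∀ i ∈ s, 0 ≤ w i) ∧ (∀ i ∈ s, 1 ≤ k i) ∧ (M ≠ 0 → ∑ i ∈ s, w i = 1) ∧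
      ∀ (a : Type) [Fintype a] [DecidableEq a] (ρ : Matrix a a ℂ),
        momentFn M ρ = 1 - ∑ i ∈ s, w i * moment (k i) ρ := by
  by_cases hM : Even M
  · obtain ⟨r, hr⟩ := hM
    have hr2 : M / 2 = r := by omega
    have hMr : (M : ℝ) = r + r := by rw [hr]; push_cast; ring
    refine ⟨ℕ ⊕ ℕ, (Finset.Icc 1 r).disjSum (Finset.Icc 1 r),
      Sum.elim (fun i => (4 * i : ℝ) / ((M : ℝ) ^ 2 + 2 * M))
        (fun i => (2 * M - 4 * i + 4 : ℝ) / ((M : ℝ) ^ 2 + 2 * M)),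
      Sum.elim id (fun i => i + r), ?_, ?_, ?_, ?_⟩
    · rintro (i | i) hi
      · simp only [Sum.elim_inl]; positivity
      · simp only [Finset.inr_mem_disjSum, Finset.mem_Icc] at hi
        have : (i : ℝ) ≤ r := by exact_mod_cast hi.2
        simp only [Sum.elim_inr]
        apply div_nonneg
        · rw [hMr]; linarith
        · positivity
    · rintro (i | i) hi
      · simpa using (Finset.mem_Icc.1 (Finset.inl_mem_disjSum.1 hi)).1
      · have := (Finset.mem_Icc.1 (Finset.inr_mem_disjSum.1 hi)).1
        simp only [Sum.elim_inr]; omega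
    · intro hM0
      have hr0 : (r : ℝ) ≠ 0 := by
        intro h
        have : r = 0 := by exact_mod_cast h
        omega
      have hr1 : (r : ℝ) + 1 ≠ 0 := by positivity
      rw [Finset.sum_disjSum, ← Finset.sum_add_distrib]
      -- The two weights carrying the same index add up to a constant, and there are `r` such pairs.
      have : ∀ i ∈ Finset.Icc 1 r, (4 * i : ℝ) / ((M : ℝ) ^ 2 + 2 * M)
          + (2 * M - 4 * i + 4 : ℝ) / ((M : ℝ) ^ 2 + 2 * M) = 1 / r := by
        intro i _
        have : (M : ℝ) ^ 2 + 2 * M ≠ 0 := by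
          rw [hMr, show ((r : ℝ) + r) ^ 2 + 2 * (r + r) = 4 * (r * (r + 1)) by ring]
          exact mul_ne_zero (by norm_num) (mul_ne_zero hr0 hr1)
        field_simp
        rw [hMr]; ring
      simp only [Sum.elim_inl, Sum.elim_inr]
      rw [Finset.sum_congr rfl this]
      simp [hr0]
    · intro a _ _ ρ
      rw [momentFn, if_pos ⟨r, hr⟩, hr2, Finset.sum_disjSum, ← Finset.sum_add_distrib]
      simp
  · obtain ⟨r, hr⟩ := Nat.not_even_iff_odd.1 hM
    have hr2 : (M - 1) / 2 = r := by omega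
    have hr3 : (M + 1) / 2 = r + 1 := by omega
    have hMr : (M : ℝ) = 2 * r + 1 := by rw [hr]; push_cast; ring
    refine ⟨(ℕ ⊕ ℕ) ⊕ Unit,
      ((Finset.Icc 1 r).disjSum (Finset.Icc 1 r)).disjSum Finset.univ,
      Sum.elim (Sum.elim (fun i => (4 * i : ℝ) / ((M : ℝ) + 1) ^ 2)
        (fun i => (2 * M - 4 * i + 2 : ℝ) / ((M : ℝ) + 1) ^ 2)) (fun _ => 2 / ((M : ℝ) + 1)),
      Sum.elim (Sum.elim id (fun i => r + 1 + i)) (fun _ => r + 1), ?_, ?_, ?_, ?_⟩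
    · rintro ((i | i) | i) hi
      · simp only [Sum.elim_inl]; positivity
      · simp only [Finset.inl_mem_disjSum, Finset.inr_mem_disjSum, Finset.mem_Icc] at hi
        have : (i : ℝ) ≤ r := by exact_mod_cast hi.2
        simp only [Sum.elim_inr, Sum.elim_inl]
        apply div_nonneg
        · rw [hMr]; linarith
        · positivity
      · simp only [Sum.elim_inr]; positivity
    · rintro ((i | i) | i) hi
      · simpa using (Finset.mem_Icc.1 (Finset.inl_mem_disjSum.1 (Finset.inl_mem_disjSum.1 hi))).1
      · simp only [Sum.elim_inr, Sum.elim_inl]; omega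
      · simp only [Sum.elim_inr]; omega
    · intro _
      have hr1 : (r : ℝ) + 1 ≠ 0 := by positivity
      rw [Finset.sum_disjSum, Finset.sum_disjSum, ← Finset.sum_add_distrib]
      -- Here `r` pairs give `r / (r + 1)`; the unpaired middle moment supplies the missing `1 / (r
      -- + 1)`.
      have : ∀ i ∈ Finset.Icc 1 r, (4 * i : ℝ) / ((M : ℝ) + 1) ^ 2
          + (2 * M - 4 * i + 2 : ℝ) / ((M : ℝ) + 1) ^ 2 = 1 / (r + 1) := by
        intro i _
        have : (M : ℝ) + 1 ≠ 0 := by positivity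
        field_simp
        rw [hMr]; ring
      simp only [Sum.elim_inl, Sum.elim_inr]
      rw [Finset.sum_congr rfl this]
      simp only [hMr, Finset.sum_const, Nat.card_Icc, Finset.card_univ]
      simp
      field_simp
      ring
    · intro a _ _ ρ
      rw [momentFn, if_neg hM, hr2, hr3, Finset.sum_disjSum, Finset.sum_disjSum,
        ← Finset.sum_add_distrib]
      simp
      ring

/-- Jensen's inequality for the diagonal entries of a power of a positive semidefinite matrix. -/
theorem diag_pow_le {A : Matrix a a ℂ} (hA : A.PosSemidef) (k : ℕ) (l : a) :
    (A l l).re ^ k ≤ ((A ^ k) l l).re := by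
  obtain ⟨U, μ, hUU, hUU', hsp, hμ⟩ : ∃ (U : Matrix a a ℂ) (μ : a → ℝ), star U * U = 1 ∧
      U * star U = 1 ∧ A = U * Matrix.diagonal (fun i => (μ i : ℂ)) * star U ∧ ∀ i, 0 ≤ μ i := by
    refine ⟨hA.1.eigenvectorUnitary.1, hA.1.eigenvalues,
      Unitary.coe_star_mul_self hA.1.eigenvectorUnitary,
      Unitary.coe_mul_star_self hA.1.eigenvectorUnitary, ?_, hA.eigenvalues_nonneg⟩
    conv_lhs => rw [hA.1.spectral_theorem, Unitary.conjStarAlgAut_apply]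
    rfl
  have hpow : ∀ k : ℕ, A ^ k =
      U * Matrix.diagonal (fun i => (μ i : ℂ) ^ k) * star U := by
    intro k
    induction k with
    | zero => simp [hUU']
    | succ k ih =>
      rw [pow_succ, ih]
      nth_rewrite 1 [hsp]
      rw [show U * Matrix.diagonal (fun i => (μ i : ℂ) ^ k) * star U *
          (U * Matrix.diagonal (fun i => (μ i : ℂ)) * star U) =
          U * (Matrix.diagonal (fun i => (μ i : ℂ) ^ k) * (star U * U) *
          Matrix.diagonal (fun i => (μ i : ℂ))) * star U by
        simp only [Matrix.mul_assoc], hUU, Matrix.mul_one, Matrix.diagonal_mul_diagonal]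
      simp only [pow_succ]
  -- The weights `|U l i|²` do not depend on `k`: order 0 shows that they sum to 1, order 1 that
  -- their mean of the eigenvalues is `A l l`.
  have hent : ∀ k : ℕ, ((A ^ k) l l).re = ∑ i, Complex.normSq (U l i) * μ i ^ k := by
    intro k
    rw [hpow k, Matrix.mul_apply, Complex.re_sum]
    refine Finset.sum_congr rfl fun i _ => ?_
    rw [Matrix.mul_diagonal, Matrix.star_apply, mul_right_comm, ← Complex.ofReal_pow,
      Complex.star_def, Complex.mul_conj, ← Complex.ofReal_mul, Complex.ofReal_re]
  have h1 : ∑ i, Complex.normSq (U l i) = 1 := by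
    have := hent 0
    simpa using this.symm
  have := Real.pow_arith_mean_le_arith_mean_pow Finset.univ (fun i => Complex.normSq (U l i))
    μ (fun i _ => Complex.normSq_nonneg _) h1 (fun i _ => hμ i) k
  rw [hent k]
  convert this using 2
  simpa using hent 1

theorem moment_unitary_conj {U : Matrix a a ℂ} (hU : U ∈ Matrix.unitaryGroup a ℂ) (k : ℕ)
    (A : Matrix a a ℂ) : moment k (U * A * Uᴴ) = moment k A := by
  have hUU : Uᴴ * U = 1 := Matrix.mem_unitaryGroup_iff'.1 hU
  have hUU' : U * Uᴴ = 1 := Matrix.mem_unitaryGroup_iff.1 hU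
  have : ∀ k : ℕ, (U * A * Uᴴ) ^ k = U * A ^ k * Uᴴ := by
    intro k
    induction k with
    | zero => simp [hUU']
    | succ k ih =>
      rw [pow_succ, ih, show U * A ^ k * Uᴴ * (U * A * Uᴴ) = U * A ^ k * (Uᴴ * U) * A * Uᴴ by
        simp only [Matrix.mul_assoc], hUU, Matrix.mul_one, Matrix.mul_assoc U, ← pow_succ]
  rw [moment, moment, this, Matrix.trace_mul_cycle, hUU, Matrix.one_mul]

theorem moment_smul (k : ℕ) (t : ℝ) (A : Matrix a a ℂ) :
    moment k (t • A) = t ^ k * moment k A := by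
  rw [moment, moment, smul_pow, Matrix.trace_smul, Complex.smul_re, smul_eq_mul]

/-- The moments are convex on positive semidefinite matrices. -/
theorem moment_sum_le {ι : Type} [Fintype ι] (k : ℕ) (p : ι → ℝ) (hp : ∀ i, 0 ≤ p i)
    (hp1 : ∑ i, p i = 1) (σ : ι → Matrix a a ℂ) (hσ : ∀ i, (σ i).PosSemidef) :
    moment k (∑ i, p i • σ i) ≤ ∑ i, p i * moment k (σ i) := by
  have hμ : (∑ i, p i • σ i).IsHermitian :=
    (Matrix.posSemidef_sum _ fun i _ => (hσ i).smul (hp i)).1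
  -- In an eigenbasis of the average, its moment is the sum of powers of its diagonal entries.
  -- Jensen is then used twice: for the weights `p`, and within each `σ i` through `diag_pow_le`.
  set U : Matrix a a ℂ := (star hμ.eigenvectorUnitary).1
  have hUm : U ∈ Matrix.unitaryGroup a ℂ := (star hμ.eigenvectorUnitary).2
  have hdiag : U * (∑ i, p i • σ i) * Uᴴ = Matrix.diagonal (fun l => (hμ.eigenvalues l : ℂ)) := by
    have := hμ.conjStarAlgAut_star_eigenvectorUnitary
    rw [Unitary.conjStarAlgAut_apply] at this
    exact this
  have hlhs : moment k (∑ i, p i • σ i) = ∑ l, (∑ i, p i * ((U * σ i * Uᴴ) l l).re) ^ k := by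
    rw [← moment_unitary_conj hUm, moment, hdiag, Matrix.diagonal_pow, Matrix.trace_diagonal,
      Complex.re_sum]
    refine Finset.sum_congr rfl fun l _ => ?_
    have : (hμ.eigenvalues l : ℂ) = ∑ i, (p i : ℂ) * (U * σ i * Uᴴ) l l := by
      have h := congrFun (congrFun hdiag l) l
      rw [Matrix.diagonal_apply_eq] at h
      rw [← h, Finset.mul_sum, Finset.sum_mul, Matrix.sum_apply]
      refine Finset.sum_congr rfl fun i _ => ?_
      rw [Matrix.mul_smul, Matrix.smul_mul, Matrix.smul_apply, Complex.real_smul]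
    have h2 : hμ.eigenvalues l = ∑ i, p i * ((U * σ i * Uᴴ) l l).re := by
      rw [← Complex.ofReal_re (hμ.eigenvalues l), this, Complex.re_sum]
      simp
    rw [← h2, Pi.pow_apply, ← Complex.ofReal_pow, Complex.ofReal_re]
  rw [hlhs]
  calc ∑ l, (∑ i, p i * ((U * σ i * Uᴴ) l l).re) ^ k
      ≤ ∑ l, ∑ i, p i * ((U * σ i * Uᴴ) l l).re ^ k := by
        refine Finset.sum_le_sum fun l _ => ?_
        refine Real.pow_arith_mean_le_arith_mean_pow _ _ _ (fun i _ => hp i) hp1 (fun i _ => ?_) k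
        exact (Complex.nonneg_iff.1 ((hσ i).mul_mul_conjTranspose_same U).diag_nonneg).1
    _ ≤ ∑ l, ∑ i, p i * (((U * σ i * Uᴴ) ^ k) l l).re := by
        refine Finset.sum_le_sum fun l _ => Finset.sum_le_sum fun i _ => ?_
        exact mul_le_mul_of_nonneg_left
          (diag_pow_le ((hσ i).mul_mul_conjTranspose_same U) k l) (hp i)
    _ = ∑ i, p i * moment k (σ i) := by
        rw [Finset.sum_comm]
        refine Finset.sum_congr rfl fun i _ => ?_
        rw [← Finset.mul_sum, ← moment_unitary_conj hUm, moment, Matrix.trace, Complex.re_sum]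
        rfl

end Moments

/-! ### The homogeneous extension and reduced states of pure vectors. -/

section Homogeneous

variable {a b : Type} [Fintype a] [DecidableEq a] [Fintype b] [DecidableEq b]

/-- The extension of `momentFn` from density matrices to positive semidefinite matrices that is
homogeneous of degree one. -/
noncomputable def homMomentFn (M : ℕ) (σ : Matrix a a ℂ) : ℝ :=
  σ.trace.re * momentFn M (σ.trace.re⁻¹ • σ)

theorem sum_mul_momentFn_le (M : ℕ) {ι : Type} [Fintype ι] (p : ι → ℝ) (hp : ∀ i, 0 ≤ p i)
    (hp1 : ∑ i, p i = 1) (σ : ι → Matrix a a ℂ) (hσ : ∀ i, (σ i).PosSemidef) :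
    ∑ i, p i * momentFn M (σ i) ≤ momentFn M (∑ i, p i • σ i) := by
  obtain ⟨κ, s, w, k, hw, -, -, h⟩ := exists_momentFn_eq M
  simp only [h, mul_sub, mul_one, Finset.sum_sub_distrib, hp1, Finset.mul_sum]
  rw [Finset.sum_comm]
  refine sub_le_sub_left (Finset.sum_le_sum fun x hx => ?_) _
  refine (mul_le_mul_of_nonneg_left (moment_sum_le (k x) p hp hp1 σ hσ) (hw x hx)).trans_eq ?_
  rw [Finset.mul_sum]
  exact Finset.sum_congr rfl fun i _ => by ring

omit [DecidableEq a] in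
theorem trace_re_nonneg {σ : Matrix a a ℂ} (hσ : σ.PosSemidef) : 0 ≤ σ.trace.re :=
  (Complex.nonneg_iff.1 hσ.trace_nonneg).1

omit [DecidableEq a] in
theorem eq_zero_of_trace_re_eq_zero {σ : Matrix a a ℂ} (hσ : σ.PosSemidef)
    (h : σ.trace.re = 0) : σ = 0 :=
  hσ.trace_eq_zero_iff.1 (Complex.ext h (Complex.nonneg_iff.1 hσ.trace_nonneg).2.symm)

theorem homMomentFn_zero (M : ℕ) : homMomentFn M (0 : Matrix a a ℂ) = 0 := by
  simp [homMomentFn]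

theorem homMomentFn_smul (M : ℕ) (c : ℝ) (σ : Matrix a a ℂ) :
    homMomentFn M (c • σ) = c * homMomentFn M σ := by
  rcases eq_or_ne c 0 with rfl | hc
  · simp [homMomentFn_zero]
  · rw [homMomentFn, homMomentFn, Matrix.trace_smul, Complex.smul_re, smul_eq_mul, smul_smul,
      mul_inv, show c⁻¹ * σ.trace.re⁻¹ * c = σ.trace.re⁻¹ by field_simp, mul_assoc]

theorem homMomentFn_of_trace_eq_one (M : ℕ) {σ : Matrix a a ℂ} (h : σ.trace = 1) :
    homMomentFn M σ = momentFn M σ := by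
  simp [homMomentFn, h]

/-- Concavity of the moment combination, in homogeneous form. -/
theorem sum_homMomentFn_le (M : ℕ) {ι : Type} [Fintype ι] (σ : ι → Matrix a a ℂ)
    (hσ : ∀ i, (σ i).PosSemidef) :
    ∑ i, homMomentFn M (σ i) ≤ homMomentFn M (∑ i, σ i) := by
  have ht : ∀ i, 0 ≤ (σ i).trace.re := fun i => trace_re_nonneg (hσ i)
  have hsum : (∑ i, σ i).trace.re = ∑ i, (σ i).trace.re := by
    rw [Matrix.trace_sum, Complex.re_sum]
  set t := (∑ i, σ i).trace.re with htdef
  have ht0 : 0 ≤ t := hsum ▸ Finset.sum_nonneg fun i _ => ht i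
  rcases ht0.eq_or_lt with h0 | hpos
  · have hz : ∀ i, (σ i).trace.re = 0 := by
      intro i
      rw [← h0] at hsum
      exact (Finset.sum_eq_zero_iff_of_nonneg fun i _ => ht i).1 hsum.symm i (Finset.mem_univ i)
    rw [homMomentFn, ← htdef, ← h0]
    simp [homMomentFn, hz]
  -- Concavity is applied to the normalized summands, weighted by their shares of the total trace.
  · have key := sum_mul_momentFn_le M (fun i => t⁻¹ * (σ i).trace.re)
      (fun i => mul_nonneg (inv_nonneg.2 ht0) (ht i))
      (by rw [← Finset.mul_sum, ← hsum, inv_mul_cancel₀ hpos.ne'])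
      (fun i => (σ i).trace.re⁻¹ • σ i) (fun i => (hσ i).smul (inv_nonneg.2 (ht i)))
    have hσt : ∑ i, (t⁻¹ * (σ i).trace.re) • ((σ i).trace.re⁻¹ • σ i) = t⁻¹ • ∑ i, σ i := by
      rw [Finset.smul_sum]
      refine Finset.sum_congr rfl fun i _ => ?_
      -- With trace 0 the inverse is the default 0, which is harmless because the summand itself is
      -- 0.
      rcases eq_or_ne (σ i).trace.re 0 with h | h
      · rw [eq_zero_of_trace_re_eq_zero (hσ i) h]; simp
      · rw [smul_smul, mul_assoc, mul_inv_cancel₀ h, mul_one]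
    rw [hσt] at key
    have := mul_le_mul_of_nonneg_left key ht0
    rw [Finset.mul_sum] at this
    refine le_trans (le_of_eq (Finset.sum_congr rfl fun i _ => ?_)) this
    rw [homMomentFn, ← mul_assoc, ← mul_assoc, mul_inv_cancel₀ hpos.ne', one_mul]

theorem ketbra_pow_succ (v : a → ℂ) (k : ℕ) :
    ketbra v ^ (k + 1) = (star v ⬝ᵥ v) ^ k • ketbra v := by
  induction k with
  | zero => simp
  | succ k ih =>
    rw [pow_succ, ih, ketbra, Matrix.smul_mul, Matrix.vecMulVec_mul_vecMulVec,
      Matrix.vecMulVec_smul, smul_smul, pow_succ]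

omit [DecidableEq a] in
theorem trace_ketbra (v : a → ℂ) : (ketbra v).trace = star v ⬝ᵥ v := by
  rw [ketbra, Matrix.trace_vecMulVec, dotProduct_comm]

omit [DecidableEq a] in
theorem posSemidef_ketbra (v : a → ℂ) : (ketbra v).PosSemidef :=
  Matrix.posSemidef_vecMulVec_self_star v

omit [DecidableEq a] in
theorem trace_ketbra_eq_ofReal (v : a → ℂ) : star v ⬝ᵥ v = ((ketbra v).trace.re : ℂ) := by
  rw [← trace_ketbra]
  exact Complex.ext rfl (Complex.nonneg_iff.1 (posSemidef_ketbra v).trace_nonneg).2.symm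

theorem moment_ketbra (v : a → ℂ) {k : ℕ} (hk : 1 ≤ k) :
    moment k (ketbra v) = (ketbra v).trace.re ^ k := by
  obtain ⟨k, rfl⟩ := Nat.exists_eq_add_of_le' hk
  rw [moment, ketbra_pow_succ, Matrix.trace_smul, trace_ketbra, smul_eq_mul, ← pow_succ,
    trace_ketbra_eq_ofReal, ← Complex.ofReal_pow, Complex.ofReal_re]
  simp

/-- A normalized rank-one projection has every moment of positive order equal to 1, so the weighted
mean is 1. For `M = 0` the sum of weights is empty and this fails. -/
theorem homMomentFn_ketbra {M : ℕ} (hM : M ≠ 0) (v : a → ℂ) : homMomentFn M (ketbra v) = 0 := by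
  obtain ⟨κ, s, w, k, -, hk, hw1, h⟩ := exists_momentFn_eq M
  rcases eq_or_ne (ketbra v).trace.re 0 with h0 | h0
  · rw [homMomentFn, h0, zero_mul]
  · rw [homMomentFn, h, ← hw1 hM]
    have : ∀ i ∈ s, w i * moment (k i) ((ketbra v).trace.re⁻¹ • ketbra v) = w i := by
      intro i hi
      rw [moment_smul, moment_ketbra v (hk i hi), ← mul_pow, inv_mul_cancel₀ h0, one_pow, mul_one]
    rw [Finset.sum_congr rfl this, sub_self, mul_zero]

omit [DecidableEq a] in
theorem exists_eq_sum_ketbra {σ : Matrix a a ℂ} (hσ : σ.PosSemidef) :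
    ∃ (k : ℕ) (v : Fin k → a → ℂ), σ = ∑ i, ketbra (v i) :=
  Matrix.posSemidef_iff_eq_sum_vecMulVec.1 hσ

/-- Superadditivity along a decomposition into rank-one terms, each contributing 0. -/
theorem homMomentFn_nonneg {M : ℕ} (hM : M ≠ 0) {σ : Matrix a a ℂ} (hσ : σ.PosSemidef) :
    0 ≤ homMomentFn M σ := by
  obtain ⟨k, v, rfl⟩ := exists_eq_sum_ketbra hσ
  refine le_trans (le_of_eq ?_) (sum_homMomentFn_le M _ fun i => posSemidef_ketbra (v i))
  simp [homMomentFn_ketbra hM]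

/-- The homogeneous moment combination depends only on the moments of positive order. -/
theorem homMomentFn_congr (M : ℕ) {σ : Matrix a a ℂ} {τ : Matrix b b ℂ}
    (h : ∀ k, 1 ≤ k → moment k σ = moment k τ) : homMomentFn M σ = homMomentFn M τ := by
  obtain ⟨κ, s, w, k, -, hk, -, hf⟩ := exists_momentFn_eq M
  have ht : σ.trace.re = τ.trace.re := by simpa [moment] using h 1 le_rfl
  rw [homMomentFn, homMomentFn, hf, hf, ht]
  congr 2
  refine Finset.sum_congr rfl fun i hi => ?_
  rw [moment_smul, moment_smul, h _ (hk i hi)]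

/-- Cyclicity of the trace. Order 0 must be excluded, since it would compare dimensions. -/
theorem moment_mul_comm (A : Matrix a b ℂ) (B : Matrix b a ℂ) {k : ℕ} (hk : 1 ≤ k) :
    moment k (A * B) = moment k (B * A) := by
  obtain ⟨k, rfl⟩ := Nat.exists_eq_add_of_le' hk
  have : (A * B) ^ (k + 1) = A * ((B * A) ^ k * B) := by
    induction k with
    | zero => simp
    | succ k ih => rw [pow_succ, ih (by omega), pow_succ]; simp only [Matrix.mul_assoc]
  rw [moment, moment, this, Matrix.trace_mul_comm, Matrix.mul_assoc, ← pow_succ]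

theorem moment_transpose (A : Matrix a a ℂ) (k : ℕ) : moment k Aᵀ = moment k A := by
  rw [moment, moment, ← Matrix.transpose_pow, Matrix.trace_transpose]

omit [Fintype a] [DecidableEq a] [DecidableEq b] in
-- Reading `ψ` as a coefficient matrix `A` turns its reduced state into `A * Aᴴ`.
theorem partialTraceB_ketbra (ψ : a × b → ℂ) :
    partialTraceB (ketbra ψ) =
      (Matrix.of fun i j => ψ (i, j)) * (Matrix.of fun i j => ψ (i, j))ᴴ := by
  ext i i'
  simp [partialTraceB, ketbra, Matrix.mul_apply, Matrix.vecMulVec_apply]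

omit [DecidableEq a] [DecidableEq b] in
theorem posSemidef_partialTraceB_ketbra (ψ : a × b → ℂ) :
    (partialTraceB (ketbra ψ)).PosSemidef := by
  rw [partialTraceB_ketbra]
  exact Matrix.posSemidef_self_mul_conjTranspose _

omit [DecidableEq a] [DecidableEq b] in
theorem trace_partialTraceB (ρ : Matrix (a × b) (a × b) ℂ) : (partialTraceB ρ).trace = ρ.trace := by
  simp [partialTraceB, Matrix.trace, Fintype.sum_prod_type]

omit [Fintype a] [DecidableEq a] [DecidableEq b] in
theorem partialTraceB_sum {ι : Type} [Fintype ι] (ρ : ι → Matrix (a × b) (a × b) ℂ) :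
    partialTraceB (∑ i, ρ i) = ∑ i, partialTraceB (ρ i) := by
  ext x y
  simp only [partialTraceB, Matrix.sum_apply, Matrix.of_apply]
  exact Finset.sum_comm

omit [Fintype a] [DecidableEq a] [DecidableEq b] in
theorem partialTraceB_smul (c : ℝ) (ρ : Matrix (a × b) (a × b) ℂ) :
    partialTraceB (c • ρ) = c • partialTraceB ρ := by
  ext x y
  simp [partialTraceB, Finset.mul_sum]

/-- The two reduced states of a pure state have the same moments. -/
theorem homMomentFn_partialTraceB_swap (M : ℕ) (ψ : a × b → ℂ) :
    homMomentFn M (partialTraceB (ketbra (ψ ∘ Prod.swap))) =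
      homMomentFn M (partialTraceB (ketbra ψ)) := by
  refine homMomentFn_congr M fun k hk => ?_
  -- Swapping the factors replaces `A * Aᴴ` by the transpose of `Aᴴ * A`.
  rw [partialTraceB_ketbra ψ, moment_mul_comm _ _ hk, ← moment_transpose, partialTraceB_ketbra]
  congr 1
  ext i j
  simp [Matrix.mul_apply, mul_comm]

omit [Fintype a] [DecidableEq a] in
theorem ketbra_smul (c : ℝ) (hc : 0 ≤ c) (v : a → ℂ) :
    ketbra ((Real.sqrt c : ℂ) • v) = c • ketbra v := by
  have h : (Real.sqrt c : ℂ) * Real.sqrt c = c := by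
    rw [← Complex.ofReal_mul, Real.mul_self_sqrt hc]
  ext i j
  simp only [ketbra, Matrix.vecMulVec_apply, Pi.smul_apply, Pi.star_apply, smul_eq_mul, star_mul',
    Matrix.smul_apply, Complex.real_smul, ← h, Complex.star_def, Complex.conj_ofReal]
  ring

end Homogeneous

/-! ### Calculus of unnormalized decompositions. -/

section RoofSums

variable {a b : Type} [Fintype a] [DecidableEq a] [Fintype b]

/-- The sums of the homogeneous moment combination over the decompositions of a positive
semidefinite matrix into unnormalized pure states. -/
def roofSums (M : ℕ) (ρ : Matrix (a × b) (a × b) ℂ) : Set ℝ :=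
  {x | ∃ (ι : Type) (_ : Fintype ι) (φ : ι → a × b → ℂ),
    ρ = ∑ i, ketbra (φ i) ∧ x = ∑ i, homMomentFn M (partialTraceB (ketbra (φ i)))}

theorem homMomentFn_mem_roofSums (M : ℕ) (φ : a × b → ℂ) :
    homMomentFn M (partialTraceB (ketbra φ)) ∈ roofSums M (ketbra φ) :=
  ⟨Unit, inferInstance, fun _ => φ, by simp, by simp⟩

theorem sum_mem_roofSums (M : ℕ) {ι : Type} [Fintype ι] {ρ : ι → Matrix (a × b) (a × b) ℂ}
    {x : ι → ℝ} (h : ∀ i, x i ∈ roofSums M (ρ i)) : ∑ i, x i ∈ roofSums M (∑ i, ρ i) := by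
  choose κ hκ φ hρ hx using h
  refine ⟨Σ i, κ i, inferInstance, fun i => φ i.1 i.2, ?_, ?_⟩
  · rw [Fintype.sum_sigma]
    exact Finset.sum_congr rfl fun i _ => hρ i
  · rw [Fintype.sum_sigma]
    exact Finset.sum_congr rfl fun i _ => hx i

theorem smul_mem_roofSums {M : ℕ} {c : ℝ} (hc : 0 ≤ c) {ρ : Matrix (a × b) (a × b) ℂ} {x : ℝ}
    (h : x ∈ roofSums M ρ) : c * x ∈ roofSums M (c • ρ) := by
  obtain ⟨ι, _, φ, rfl, rfl⟩ := h
  refine ⟨ι, inferInstance, fun i => (Real.sqrt c : ℂ) • φ i, ?_, ?_⟩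
  · simp only [ketbra_smul c hc, Finset.smul_sum]
  · simp only [ketbra_smul c hc, partialTraceB_smul, homMomentFn_smul, Finset.mul_sum]

theorem nonneg_of_mem_roofSums {M : ℕ} (hM : M ≠ 0) {ρ : Matrix (a × b) (a × b) ℂ} {x : ℝ}
    (h : x ∈ roofSums M ρ) : 0 ≤ x := by
  obtain ⟨ι, _, φ, rfl, rfl⟩ := h
  exact Finset.sum_nonneg fun i _ => homMomentFn_nonneg hM (posSemidef_partialTraceB_ketbra _)

theorem posSemidef_of_mem_roofSums {M : ℕ} {ρ : Matrix (a × b) (a × b) ℂ} {x : ℝ}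
    (h : x ∈ roofSums M ρ) : ρ.PosSemidef := by
  obtain ⟨ι, _, φ, rfl, rfl⟩ := h
  exact Matrix.posSemidef_sum _ fun i _ => posSemidef_ketbra _

theorem roofSums_nonempty (M : ℕ) {ρ : Matrix (a × b) (a × b) ℂ} (hρ : ρ.PosSemidef) :
    (roofSums M ρ).Nonempty := by
  obtain ⟨k, v, h⟩ := exists_eq_sum_ketbra hρ
  exact ⟨_, Fin k, inferInstance, v, h, rfl⟩

theorem zero_mem_roofSums (M : ℕ) : 0 ∈ roofSums M (0 : Matrix (a × b) (a × b) ℂ) :=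
  ⟨Empty, inferInstance, fun i => i.elim, by simp, by simp⟩

theorem mem_roofSums_swap [DecidableEq b] {M : ℕ} {ρ : Matrix (a × b) (a × b) ℂ} {x : ℝ}
    (h : x ∈ roofSums M ρ) : x ∈ roofSums M (ρ.submatrix Prod.swap Prod.swap) := by
  obtain ⟨ι, _, φ, rfl, rfl⟩ := h
  refine ⟨ι, inferInstance, fun i => φ i ∘ Prod.swap, ?_, ?_⟩
  · ext x y
    simp [Matrix.sum_apply, ketbra, Matrix.vecMulVec_apply]
  · simp only [homMomentFn_partialTraceB_swap]

end RoofSums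

/-! ### Monotonicity under protocols. -/

section LOCC

/-- A local instrument on the second party does not increase the roof sums on average. -/
theorem exists_roofSums_onB (M : ℕ) {m n r : ℕ} {e : Fin r → ℕ}
    {Φ : ∀ j, SuperOp (Fin n) (Fin (e j))} (hΦ : IsInstrument Φ)
    {ρ : Matrix (Fin m × Fin n) (Fin m × Fin n) ℂ} {x : ℝ} (hx : x ∈ roofSums M ρ) :
    ∃ y : Fin r → ℝ, (∀ j, y j ∈ roofSums M (onB (Fin m) (Φ j) ρ)) ∧ ∑ j, y j ≤ x := by
  have pure : ∀ ψ : Fin m × Fin n → ℂ, ∃ y : Fin r → ℝ,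
      (∀ j, y j ∈ roofSums M (onB (Fin m) (Φ j) (ketbra ψ))) ∧
      ∑ j, y j ≤ homMomentFn M (partialTraceB (ketbra ψ)) := by
    intro ψ
    -- Complete positivity lets each outcome on a pure input be split into unnormalized vectors
    -- again.
    choose k v hv using fun j =>
      exists_eq_sum_ketbra (hΦ.1 j m (ketbra ψ) (posSemidef_ketbra ψ))
    refine ⟨fun j => ∑ l, homMomentFn M (partialTraceB (ketbra (v j l))),
      fun j => ⟨Fin (k j), inferInstance, v j, hv j, rfl⟩, ?_⟩
    -- No signalling: entry `(s, t)` is trace preservation of the instrument on the corresponding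
    -- block of `ketbra ψ`.
    have hred : partialTraceB (ketbra ψ) =
        ∑ i : (Σ j, Fin (k j)), partialTraceB (ketbra (v i.1 i.2)) := by
      rw [Fintype.sum_sigma]
      have hj : ∀ j, ∑ l, partialTraceB (ketbra (v j l)) =
          partialTraceB (onB (Fin m) (Φ j) (ketbra ψ)) := fun j => by
        rw [hv j, partialTraceB_sum]
      simp only [hj]
      ext s t
      rw [Matrix.sum_apply]
      exact (hΦ.2 (Matrix.of fun u v => ketbra ψ (s, u) (t, v))).symm
    rw [hred]
    refine le_trans (le_of_eq ?_)
      (sum_homMomentFn_le M _ fun i => posSemidef_partialTraceB_ketbra _)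
    rw [Fintype.sum_sigma]
  obtain ⟨ι, _, φ, rfl, rfl⟩ := hx
  choose y hy hle using fun i => pure (φ i)
  refine ⟨fun j => ∑ i, y i j, fun j => ?_, ?_⟩
  · rw [map_sum]
    exact sum_mem_roofSums M fun i => hy i j
  · rw [Finset.sum_comm]
    exact Finset.sum_le_sum fun i _ => hle i

/-- Swapping the factors turns `onA` into `onB` and preserves roof sums. -/
theorem exists_roofSums_onA (M : ℕ) {m n r : ℕ} {e : Fin r → ℕ}
    {Φ : ∀ j, SuperOp (Fin m) (Fin (e j))} (hΦ : IsInstrument Φ)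
    {ρ : Matrix (Fin m × Fin n) (Fin m × Fin n) ℂ} {x : ℝ} (hx : x ∈ roofSums M ρ) :
    ∃ y : Fin r → ℝ, (∀ j, y j ∈ roofSums M (onA (Fin n) (Φ j) ρ)) ∧ ∑ j, y j ≤ x := by
  obtain ⟨y, hy, hle⟩ := exists_roofSums_onB M hΦ (mem_roofSums_swap hx)
  exact ⟨y, fun j => mem_roofSums_swap (hy j), hle⟩

/-- LOCC protocols do not increase the roof sums on average. -/
theorem IsLOCC.exists_roofSums (M : ℕ) {K m n m' n' : ℕ}
    {F : Fin K → SuperOp (Fin m × Fin n) (Fin m' × Fin n')} (hF : IsLOCC F) :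
    ∀ {ρ : Matrix (Fin m × Fin n) (Fin m × Fin n) ℂ} {x : ℝ}, x ∈ roofSums M ρ →
      ∃ y : Fin K → ℝ, (∀ c, y c ∈ roofSums M (F c ρ)) ∧ ∑ c, y c ≤ x := by
  -- One round of either party, `G` being its local instrument: the values reached on each branch
  -- are added per announced outcome.
  have step : ∀ {m n r : ℕ} {e f : Fin r → ℕ}
      (G : ∀ j, SuperOp (Fin m × Fin n) (Fin (e j) × Fin (f j)))
      (F : ∀ j, Fin K → SuperOp (Fin (e j) × Fin (f j)) (Fin m' × Fin n'))
      (_ : ∀ j {σ : Matrix (Fin (e j) × Fin (f j)) (Fin (e j) × Fin (f j)) ℂ} {z : ℝ},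
        z ∈ roofSums M σ → ∃ y : Fin K → ℝ, (∀ c, y c ∈ roofSums M (F j c σ)) ∧ ∑ c, y c ≤ z)
      {ρ : Matrix (Fin m × Fin n) (Fin m × Fin n) ℂ} {x : ℝ}
      (_ : ∃ z : Fin r → ℝ, (∀ j, z j ∈ roofSums M (G j ρ)) ∧ ∑ j, z j ≤ x),
      ∃ y : Fin K → ℝ,
        (∀ c, y c ∈ roofSums M ((∑ j, F j c ∘ₗ G j) ρ)) ∧ ∑ c, y c ≤ x := by
    rintro m n r e f G F ih ρ x ⟨z, hz, hzx⟩
    choose y hy hyz using fun j => ih j (hz j)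
    refine ⟨fun c => ∑ j, y j c, fun c => ?_, ?_⟩
    · rw [LinearMap.sum_apply]
      exact sum_mem_roofSums M fun j => hy j c
    · rw [Finset.sum_comm]
      exact (Finset.sum_le_sum fun j _ => hyz j).trans hzx
  induction hF with
  | halt c =>
    intro ρ x hx
    refine ⟨Pi.single c x, fun c' => ?_, by simp⟩
    rcases eq_or_ne c' c with rfl | h
    · simpa using hx
    · simpa [h] using zero_mem_roofSums M
  | alice Φ F hΦ _ ih =>
    intro ρ x hx
    exact step (fun j => onA _ (Φ j)) F (fun j => ih j) (exists_roofSums_onA M hΦ hx)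
  | bob Φ F hΦ _ ih =>
    intro ρ x hx
    exact step (fun j => onB _ (Φ j)) F (fun j => ih j) (exists_roofSums_onB M hΦ hx)

end LOCC

end MomentEntanglement

/-- By Carathéodory at most `finrank + 1` points are needed, so the hull is a finite union of
continuous images of compact sets. -/
theorem IsCompact.convexHull_of_finiteDimensional {E : Type*} [AddCommGroup E] [Module ℝ E]
    [TopologicalSpace E] [ContinuousAdd E] [ContinuousSMul ℝ E] [FiniteDimensional ℝ E]
    {s : Set E} (hs : IsCompact s) : IsCompact (convexHull ℝ s) := by
  have h : convexHull ℝ s = ⋃ k ∈ Finset.range (Module.finrank ℝ E + 2),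
      (fun q : (Fin k → ℝ) × (Fin k → E) => ∑ i, q.1 i • q.2 i) ''
        (stdSimplex ℝ (Fin k) ×ˢ Set.univ.pi fun _ => s) := by
    ext x
    simp only [Set.mem_iUnion, Finset.mem_range, exists_prop, Set.mem_image, Set.mem_prod,
      Set.mem_univ_pi, Prod.exists]
    constructor
    · intro hx
      obtain ⟨ι, _, z, w, hz, hind, hw, hw1, hx⟩ := eq_pos_convex_span_of_mem_convexHull hx
      have hc : Fintype.card ι ≤ Module.finrank ℝ E + 1 :=
        hind.card_le_finrank_succ.trans (Nat.add_le_add_right (Submodule.finrank_le _) 1)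
      let f := (Fintype.equivFin ι).symm
      refine ⟨Fintype.card ι, by omega, w ∘ f, z ∘ f,
        ⟨⟨fun i => (hw _).le, ?_⟩, fun i => hz ⟨_, rfl⟩⟩, ?_⟩
      · rw [← hw1]; exact Equiv.sum_comp f w
      · rw [← hx]; exact Equiv.sum_comp f fun i => w i • z i
    · rintro ⟨k, -, w, z, ⟨hw, hz⟩, hx⟩
      exact mem_convexHull_of_exists_fintype w z hw.1 hw.2 hz hx
  rw [h]
  refine Finset.isCompact_biUnion _ fun k _ => IsCompact.image ?_ ?_
  · exact (isCompact_stdSimplex ℝ (Fin k)).prod (isCompact_univ_pi fun _ => hs)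
  · fun_prop

namespace MomentEntanglement

/-! ### Attainment of the minimum and values on pure states. -/

section Attained

theorem isCompact_setOf_isUnitVec (a : Type) [Fintype a] : IsCompact {ψ : a → ℂ | IsUnitVec ψ} := by
  refine Metric.isCompact_of_isClosed_isBounded ?_ ?_
  · refine isClosed_eq ?_ continuous_const
    simp only [dotProduct, Pi.star_apply]
    fun_prop
  · refine (Metric.isBounded_closedBall (x := (0 : a → ℂ)) (r := 1)).subset fun ψ hψ => ?_
    rw [mem_closedBall_zero_iff, pi_norm_le_iff_of_nonneg zero_le_one]
    intro i
    have h : ∑ i, ‖ψ i‖ ^ 2 = 1 := by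
      have h1 : star ψ ⬝ᵥ ψ = ((∑ i, ‖ψ i‖ ^ 2 : ℝ) : ℂ) := by
        push_cast
        exact Finset.sum_congr rfl fun i _ => Complex.conj_mul' (ψ i)
      exact_mod_cast h1.symm.trans hψ
    have h2 : ‖ψ i‖ ^ 2 ≤ 1 :=
      h ▸ Finset.single_le_sum (f := fun i => ‖ψ i‖ ^ 2) (fun i _ => sq_nonneg _)
        (Finset.mem_univ i)
    exact (sq_le_one_iff₀ (norm_nonneg _)).1 h2

theorem continuous_ketbra (a : Type) : Continuous (ketbra : (a → ℂ) → Matrix a a ℂ) := by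
  refine continuous_matrix fun i j => ?_
  simp only [ketbra, Matrix.vecMulVec_apply, Pi.star_apply]
  fun_prop

theorem continuous_moment {a : Type} [Fintype a] [DecidableEq a] (k : ℕ) :
    Continuous (moment k : Matrix a a ℂ → ℝ) :=
  Complex.continuous_re.comp (Continuous.matrix_trace (continuous_pow k))

theorem continuous_momentFn {a : Type} [Fintype a] [DecidableEq a] (M : ℕ) :
    Continuous (momentFn M : Matrix a a ℂ → ℝ) := by
  obtain ⟨κ, s, w, k, -, -, -, h⟩ := exists_momentFn_eq M
  rw [show (momentFn M : Matrix a a ℂ → ℝ) = fun ρ => 1 - ∑ i ∈ s, w i * moment (k i) ρ from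
    funext fun ρ => h a ρ]
  exact continuous_const.sub (continuous_finsetSum _ fun i _ =>
    continuous_const.mul (continuous_moment _))

variable {m n : ℕ}

theorem continuous_pureErm : Continuous (pureErm : (Fin m × Fin n → ℂ) → ℝ) := by
  refine (continuous_momentFn m).comp ?_
  refine continuous_matrix fun i j => ?_
  simp only [partialTraceB, Matrix.of_apply]
  exact continuous_finsetSum _ fun l _ => (continuous_ketbra _).matrix_elem _ _

/-- Ensembles are convex combinations of points on the graph of `pureErm`; fixing the average `ρ`
cuts out a fibre. This yields compactness although ensemble lengths are unbounded. -/
theorem decompositionValues_eq_image (ρ : Matrix (Fin m × Fin n) (Fin m × Fin n) ℂ) :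
    decompositionValues ρ = Prod.snd '' (convexHull ℝ
      ((fun ψ : Fin m × Fin n → ℂ => (ketbra ψ, pureErm ψ)) '' {ψ | IsUnitVec ψ}) ∩
        Prod.fst ⁻¹' {ρ}) := by
  ext x
  constructor
  · rintro ⟨k, p, ψ, ⟨hp, hp1, hψ, hρ⟩, hx⟩
    refine ⟨(ρ, x), ⟨?_, rfl⟩, rfl⟩
    refine mem_convexHull_of_exists_fintype p (fun i => (ketbra (ψ i), pureErm (ψ i))) hp hp1
      (fun i => ⟨ψ i, hψ i, rfl⟩) ?_
    ext1
    · simpa [Prod.fst_sum] using hρ.symm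
    · simpa [Prod.snd_sum] using hx.symm
  · rintro ⟨⟨ρ', x'⟩, ⟨hmem, hρ⟩, rfl⟩
    obtain rfl : ρ' = ρ := hρ
    obtain ⟨ι, _, p, z, hp, hp1, hz, hsum⟩ := mem_convexHull_iff_exists_fintype.1 hmem
    choose ψ hψ hzψ using hz
    obtain rfl : z = fun i => (ketbra (ψ i), pureErm (ψ i)) := funext fun i => (hzψ i).symm
    let f := (Fintype.equivFin ι).symm
    refine ⟨Fintype.card ι, p ∘ f, ψ ∘ f,
      ⟨fun i => hp _, ?_, fun i => hψ _, ?_⟩, ?_⟩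
    · rw [← hp1]; exact Equiv.sum_comp f p
    · have := congrArg Prod.fst hsum
      rw [Prod.fst_sum] at this
      refine Eq.trans this.symm ?_
      exact (Equiv.sum_comp f fun i => p i • ketbra (ψ i)).symm
    · have := congrArg Prod.snd hsum
      rw [Prod.snd_sum] at this
      refine Eq.trans this.symm ?_
      exact (Equiv.sum_comp f fun i => p i * pureErm (ψ i)).symm

theorem isCompact_decompositionValues (ρ : Matrix (Fin m × Fin n) (Fin m × Fin n) ℂ) :
    IsCompact (decompositionValues ρ) := by
  rw [decompositionValues_eq_image]
  refine IsCompact.image (IsCompact.inter_right ?_ (isClosed_singleton.preimage continuous_fst))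
    continuous_snd
  exact ((isCompact_setOf_isUnitVec _).image
    ((continuous_ketbra _).prodMk continuous_pureErm)).convexHull_of_finiteDimensional

theorem homMomentFn_eq_pureErm {ψ : Fin m × Fin n → ℂ} (hψ : IsUnitVec ψ) :
    homMomentFn m (partialTraceB (ketbra ψ)) = pureErm ψ :=
  homMomentFn_of_trace_eq_one m (by rw [trace_partialTraceB, trace_ketbra]; exact hψ)

/-- Every vector is a nonnegative multiple of a unit vector, as far as `ketbra` is concerned. -/
theorem exists_isUnitVec_ketbra_eq_smul {a : Type} [Fintype a] [DecidableEq a] [Nonempty a]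
    (φ : a → ℂ) :
    ∃ ψ, IsUnitVec ψ ∧ ketbra φ = (ketbra φ).trace.re • ketbra ψ := by
  have h0 := trace_re_nonneg (posSemidef_ketbra φ)
  rcases eq_or_ne (ketbra φ).trace.re 0 with h | h
  · obtain ⟨i⟩ := ‹Nonempty a›
    refine ⟨Pi.single i 1, by simp [IsUnitVec], ?_⟩
    rw [h, zero_smul]
    exact eq_zero_of_trace_re_eq_zero (posSemidef_ketbra φ) h
  · refine ⟨(Real.sqrt (ketbra φ).trace.re⁻¹ : ℂ) • φ, ?_, ?_⟩
    · rw [IsUnitVec, trace_ketbra_eq_ofReal, ketbra_smul _ (inv_nonneg.2 h0), Matrix.trace_smul,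
        Complex.smul_re, smul_eq_mul, inv_mul_cancel₀ h, Complex.ofReal_one]
    · rw [ketbra_smul _ (inv_nonneg.2 h0), smul_smul, mul_inv_cancel₀ h, one_smul]

/-- Absorb `√p` into the unit vectors; conversely, the squared norms of the vectors serve as
probabilities, summing to the trace. -/
theorem decompositionValues_eq_roofSums {ρ : Matrix (Fin m × Fin n) (Fin m × Fin n) ℂ}
    (hρ : ρ.trace = 1) : decompositionValues ρ = roofSums m ρ := by
  ext x
  constructor
  · rintro ⟨k, p, ψ, ⟨hp, hp1, hψ, rfl⟩, rfl⟩
    refine sum_mem_roofSums m fun i => smul_mem_roofSums (hp i) ?_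
    rw [← homMomentFn_eq_pureErm (hψ i)]
    exact homMomentFn_mem_roofSums m (ψ i)
  · rintro ⟨ι, _, φ, rfl, rfl⟩
    have : Nonempty (Fin m × Fin n) := by
      by_contra hne
      rw [not_nonempty_iff] at hne
      simp [Matrix.trace] at hρ
    choose ψ hψ hφ using fun i => exists_isUnitVec_ketbra_eq_smul (φ i)
    let f := (Fintype.equivFin ι).symm
    refine ⟨Fintype.card ι, fun i => (ketbra (φ (f i))).trace.re, fun i => ψ (f i),
      ⟨fun i => trace_re_nonneg (posSemidef_ketbra _), ?_, fun i => hψ _, ?_⟩, ?_⟩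
    · rw [Equiv.sum_comp f fun i => (ketbra (φ i)).trace.re, ← Complex.re_sum, ← Matrix.trace_sum,
        hρ, Complex.one_re]
    · rw [Equiv.sum_comp f fun i => (ketbra (φ i)).trace.re • ketbra (ψ i)]
      exact Finset.sum_congr rfl fun i _ => hφ i
    · rw [Equiv.sum_comp f fun i => (ketbra (φ i)).trace.re * pureErm (ψ i)]
      refine Finset.sum_congr rfl fun i _ => ?_
      rw [← homMomentFn_eq_pureErm (hψ i), ← homMomentFn_smul, ← partialTraceB_smul, ← hφ i]

theorem isLeast_Erm {ρ : Matrix (Fin m × Fin n) (Fin m × Fin n) ℂ} (hρ : IsState ρ) :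
    IsLeast (decompositionValues ρ) (Erm ρ) :=
  (isCompact_decompositionValues ρ).isLeast_sInf
    (decompositionValues_eq_roofSums hρ.2 ▸ roofSums_nonempty m hρ.1)

theorem Erm_mem_roofSums {ρ : Matrix (Fin m × Fin n) (Fin m × Fin n) ℂ} (hρ : IsState ρ) :
    Erm ρ ∈ roofSums m ρ :=
  decompositionValues_eq_roofSums hρ.2 ▸ (isLeast_Erm hρ).1

theorem Erm_le_of_mem_roofSums {ρ : Matrix (Fin m × Fin n) (Fin m × Fin n) ℂ} (hρ : IsState ρ)
    {x : ℝ} (hx : x ∈ roofSums m ρ) : Erm ρ ≤ x :=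
  (isLeast_Erm hρ).2 (decompositionValues_eq_roofSums hρ.2 ▸ hx)

/-- Supplies `M ≠ 0` wherever the weights must sum to 1. -/
theorem IsState.left_ne_zero {ρ : Matrix (Fin m × Fin n) (Fin m × Fin n) ℂ} (hρ : IsState ρ) :
    m ≠ 0 := by
  rintro rfl
  simpa [Matrix.trace] using hρ.2

theorem Erm_nonneg {ρ : Matrix (Fin m × Fin n) (Fin m × Fin n) ℂ} (hρ : IsState ρ) :
    0 ≤ Erm ρ :=
  nonneg_of_mem_roofSums hρ.left_ne_zero (Erm_mem_roofSums hρ)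

theorem isState_ketbra {a : Type} [Fintype a] [DecidableEq a] {ψ : a → ℂ} (hψ : IsUnitVec ψ) :
    IsState (ketbra ψ) :=
  ⟨posSemidef_ketbra ψ, (trace_ketbra ψ).trans hψ⟩

theorem ketbra_mulVec {a b : Type} [Fintype a] (A : Matrix b a ℂ) (φ : a → ℂ) :
    ketbra (A *ᵥ φ) = A * ketbra φ * Aᴴ := by
  rw [ketbra, ketbra, Matrix.mul_vecMulVec, Matrix.vecMulVec_mul, Matrix.star_mulVec]

/-- A decomposition of a pure state into unnormalized pure states is trivial. -/
theorem exists_eq_smul_of_ketbra_eq_sum {a ι : Type} [Fintype a] [DecidableEq a] [Fintype ι]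
    {ψ : a → ℂ} (hψ : IsUnitVec ψ) {φ : ι → a → ℂ} (h : ketbra ψ = ∑ i, ketbra (φ i)) (i : ι) :
    ∃ c : ℂ, φ i = c • ψ := by
  -- Compressing by the projection orthogonal to `ψ` annihilates the sum, hence each of its positive
  -- semidefinite terms.
  set P : Matrix a a ℂ := 1 - ketbra ψ with hP
  have hPψ : P *ᵥ ψ = 0 := by
    rw [hP, Matrix.sub_mulVec, Matrix.one_mulVec, ketbra, Matrix.vecMulVec_mulVec]
    ext j
    simp [show star ψ ⬝ᵥ ψ = 1 from hψ]
  have hsum : ∑ i, ketbra (P *ᵥ φ i) = 0 := by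
    simp only [ketbra_mulVec]
    rw [← Finset.sum_mul, ← Finset.mul_sum, ← h, ← ketbra_mulVec, hPψ]
    ext; simp [ketbra, Matrix.vecMulVec_apply]
  have htr : ∑ i, (ketbra (P *ᵥ φ i)).trace.re = 0 := by
    rw [← Complex.re_sum, ← Matrix.trace_sum, hsum]; simp
  have h0 := (Finset.sum_eq_zero_iff_of_nonneg fun i _ =>
    trace_re_nonneg (posSemidef_ketbra (P *ᵥ φ i))).1 htr i (Finset.mem_univ i)
  have h1 : star (P *ᵥ φ i) ⬝ᵥ (P *ᵥ φ i) = 0 := by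
    rw [trace_ketbra_eq_ofReal, h0, Complex.ofReal_zero]
  have h2 := dotProduct_star_self_eq_zero.1 h1
  rw [hP, Matrix.sub_mulVec, Matrix.one_mulVec, sub_eq_zero, ketbra,
    Matrix.vecMulVec_mulVec] at h2
  refine ⟨star ψ ⬝ᵥ φ i, h2.trans ?_⟩
  ext j
  simp [mul_comm]

theorem ketbra_complex_smul {a : Type} (c : ℂ) (ψ : a → ℂ) :
    ketbra (c • ψ) = Complex.normSq c • ketbra ψ := by
  ext i j
  simp only [ketbra, Matrix.vecMulVec_apply, Pi.smul_apply, Pi.star_apply, smul_eq_mul, star_mul',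
    Matrix.smul_apply, Complex.real_smul, ← Complex.mul_conj, Complex.star_def]
  ring

/-- An optimal decomposition consists of multiples `c i • ψ` with `∑ |c i|² = 1`, so its value is
forced. -/
theorem Erm_ketbra {ψ : Fin m × Fin n → ℂ} (hψ : IsUnitVec ψ) : Erm (ketbra ψ) = pureErm ψ := by
  obtain ⟨ι, _, φ, hφ, hx⟩ := Erm_mem_roofSums (isState_ketbra hψ)
  choose c hc using exists_eq_smul_of_ketbra_eq_sum hψ hφ
  simp only [hc, ketbra_complex_smul] at hφ hx
  have h1 : ∑ i, Complex.normSq (c i) = 1 := by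
    have := congrArg (fun A => (Matrix.trace A).re) hφ
    simp only [← Finset.sum_smul, Matrix.trace_smul, Complex.smul_re, (isState_ketbra hψ).2] at this
    simpa using this.symm
  rw [hx]
  simp only [partialTraceB_smul, homMomentFn_smul]
  rw [← Finset.sum_mul, h1, one_mul, homMomentFn_eq_pureErm hψ]

end Attained

/-! ### The properties of the measure. -/

section Properties

variable {m n : ℕ}

theorem IsState.add_smul {a : Type} [Fintype a] {ρ σ : Matrix a a ℂ} (hρ : IsState ρ)
    (hσ : IsState σ) {s t : ℝ} (hs : 0 ≤ s) (ht : 0 ≤ t) (hst : s + t = 1) :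
    IsState (s • ρ + t • σ) := by
  refine ⟨(hρ.1.smul hs).add (hσ.1.smul ht), ?_⟩
  rw [Matrix.trace_add, Matrix.trace_smul, Matrix.trace_smul, hρ.2, hσ.2, ← _root_.add_smul, hst,
    one_smul]

/-- Optimal decompositions of the two states, rescaled and joined, decompose the mixture. -/
theorem convexOn_Erm :
    ConvexOn ℝ {ρ : Matrix (Fin m × Fin n) (Fin m × Fin n) ℂ | IsState ρ} Erm := by
  refine ⟨fun ρ hρ σ hσ s t hs ht hst => hρ.add_smul hσ hs ht hst,
    fun ρ hρ σ hσ s t hs ht hst => ?_⟩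
  refine Erm_le_of_mem_roofSums (hρ.add_smul hσ hs ht hst) ?_
  have := sum_mem_roofSums (M := m) (ι := Bool) (ρ := fun b => cond b (s • ρ) (t • σ))
    (x := fun b => cond b (s * Erm ρ) (t * Erm σ)) (by
      rintro (_ | _)
      · exact smul_mem_roofSums ht (Erm_mem_roofSums hσ)
      · exact smul_mem_roofSums hs (Erm_mem_roofSums hρ))
  simpa using this

/-- Decomposing both factors gives product vectors, whose reduced states have rank at most one. -/
theorem zero_mem_roofSums_kronecker {a b : Type} [Fintype a] [DecidableEq a] [Fintype b]
    [DecidableEq b] {M : ℕ} (hM : M ≠ 0) {σ : Matrix a a ℂ} {τ : Matrix b b ℂ}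
    (hσ : σ.PosSemidef) (hτ : τ.PosSemidef) : 0 ∈ roofSums M (σ ⊗ₖ τ) := by
  obtain ⟨k, u, rfl⟩ := exists_eq_sum_ketbra hσ
  obtain ⟨l, v, rfl⟩ := exists_eq_sum_ketbra hτ
  refine ⟨Fin k × Fin l, inferInstance, fun i x => u i.1 x.1 * v i.2 x.2, ?_, ?_⟩
  · ext x y
    simp only [Matrix.kroneckerMap_apply, Matrix.sum_apply, Fintype.sum_prod_type,
      Finset.sum_mul_sum, ketbra, Matrix.vecMulVec_apply, Pi.star_apply, star_mul']
    exact Finset.sum_congr rfl fun i _ => Finset.sum_congr rfl fun j _ => by ring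
  · refine (Finset.sum_eq_zero fun i _ => ?_).symm
    have : partialTraceB (ketbra fun x : a × b => u i.1 x.1 * v i.2 x.2) =
        (ketbra (v i.2)).trace.re • ketbra (u i.1) := by
      ext x y
      rw [Matrix.smul_apply, Complex.real_smul, ← trace_ketbra_eq_ofReal]
      simp only [partialTraceB, ketbra, Matrix.vecMulVec_apply, Matrix.of_apply, Pi.star_apply,
        star_mul', dotProduct, Finset.sum_mul]
      exact Finset.sum_congr rfl fun j _ => by ring
    rw [this, homMomentFn_smul, homMomentFn_ketbra hM, mul_zero]

theorem IsSeparable.isState {a b : Type} [Fintype a] [DecidableEq a] [Fintype b] [DecidableEq b]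
    {ρ : Matrix (a × b) (a × b) ℂ} (hρ : IsSeparable ρ) : IsState ρ := by
  obtain ⟨k, p, σ, τ, hp, hp1, hσ, hτ, rfl⟩ := hρ
  refine ⟨Matrix.posSemidef_sum _ fun i _ => ((hσ i).1.kronecker (hτ i).1).smul (hp i), ?_⟩
  rw [Matrix.trace_sum]
  simp only [Matrix.trace_smul, Matrix.trace_kronecker, (hσ _).2, (hτ _).2, mul_one]
  rw [← Finset.sum_smul, hp1, one_smul]

theorem Erm_of_isSeparable {ρ : Matrix (Fin m × Fin n) (Fin m × Fin n) ℂ} (hρ : IsSeparable ρ) :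
    Erm ρ = 0 := by
  refine le_antisymm (Erm_le_of_mem_roofSums hρ.isState ?_) (Erm_nonneg hρ.isState)
  have hm := hρ.isState.left_ne_zero
  obtain ⟨k, p, σ, τ, hp, -, hσ, hτ, rfl⟩ := hρ
  have := sum_mem_roofSums m fun i =>
    smul_mem_roofSums (hp i) (zero_mem_roofSums_kronecker hm (hσ i).1 (hτ i).1)
  simpa using this

/-- The coefficient matrix `A` becomes `U * A * Vᵀ`: `V` cancels in the reduced state and `U`
conjugates it. -/
theorem homMomentFn_partialTraceB_kronecker_mulVec {a b : Type} [Fintype a] [DecidableEq a]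
    [Fintype b] [DecidableEq b] (M : ℕ) {U : Matrix a a ℂ} (hU : U ∈ Matrix.unitaryGroup a ℂ)
    {V : Matrix b b ℂ} (hV : V ∈ Matrix.unitaryGroup b ℂ) (φ : a × b → ℂ) :
    homMomentFn M (partialTraceB (ketbra ((U ⊗ₖ V) *ᵥ φ))) =
      homMomentFn M (partialTraceB (ketbra φ)) := by
  refine homMomentFn_congr M fun k _ => ?_
  rw [partialTraceB_ketbra φ, partialTraceB_ketbra]
  set A : Matrix a b ℂ := Matrix.of fun i j => φ (i, j)
  have h : (Matrix.of fun i j => ((U ⊗ₖ V) *ᵥ φ) (i, j)) = U * A * Vᵀ := by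
    ext i j
    simp only [Matrix.of_apply, Matrix.mulVec, dotProduct, Matrix.kroneckerMap_apply,
      Fintype.sum_prod_type, Matrix.mul_apply, Finset.sum_mul, Matrix.transpose_apply, A]
    rw [Finset.sum_comm]
    exact Finset.sum_congr rfl fun _ _ => Finset.sum_congr rfl fun _ _ => by ring
  have hVV : Vᵀ * (Vᵀ)ᴴ = 1 := by
    rw [← Matrix.transpose_one, ← (Matrix.mem_unitaryGroup_iff'.1 hV : Vᴴ * V = 1),
      Matrix.transpose_mul]
    rfl
  rw [h, Matrix.conjTranspose_mul, Matrix.conjTranspose_mul,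
    show U * A * Vᵀ * ((Vᵀ)ᴴ * (Aᴴ * Uᴴ)) = U * A * (Vᵀ * (Vᵀ)ᴴ) * Aᴴ * Uᴴ by
      simp only [Matrix.mul_assoc], hVV, Matrix.mul_one, Matrix.mul_assoc U A,
    moment_unitary_conj hU]

theorem mem_roofSums_kronecker_conj {a b : Type} [Fintype a] [DecidableEq a] [Fintype b]
    [DecidableEq b] {M : ℕ} {U : Matrix a a ℂ} (hU : U ∈ Matrix.unitaryGroup a ℂ)
    {V : Matrix b b ℂ} (hV : V ∈ Matrix.unitaryGroup b ℂ) {ρ : Matrix (a × b) (a × b) ℂ} {x : ℝ}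
    (hx : x ∈ roofSums M ρ) : x ∈ roofSums M ((U ⊗ₖ V) * ρ * (U ⊗ₖ V)ᴴ) := by
  obtain ⟨ι, _, φ, rfl, rfl⟩ := hx
  refine ⟨ι, inferInstance, fun i => (U ⊗ₖ V) *ᵥ φ i, ?_, ?_⟩
  · simp only [ketbra_mulVec, Finset.mul_sum, Finset.sum_mul]
  · simp only [homMomentFn_partialTraceB_kronecker_mulVec M hU hV]

theorem Erm_kronecker_conj {ρ : Matrix (Fin m × Fin n) (Fin m × Fin n) ℂ} (hρ : IsState ρ)
    {U : Matrix (Fin m) (Fin m) ℂ} (hU : U ∈ Matrix.unitaryGroup (Fin m) ℂ)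
    {V : Matrix (Fin n) (Fin n) ℂ} (hV : V ∈ Matrix.unitaryGroup (Fin n) ℂ) :
    Erm ((U ⊗ₖ V) * ρ * (U ⊗ₖ V)ᴴ) = Erm ρ := by
  have hW : (U ⊗ₖ V)ᴴ * (U ⊗ₖ V) = 1 := by
    rw [Matrix.conjTranspose_kronecker, ← Matrix.mul_kronecker_mul,
      show Uᴴ * U = 1 from Matrix.mem_unitaryGroup_iff'.1 hU,
      show Vᴴ * V = 1 from Matrix.mem_unitaryGroup_iff'.1 hV, Matrix.one_kronecker_one]
  have hst : IsState ((U ⊗ₖ V) * ρ * (U ⊗ₖ V)ᴴ) := by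
    refine ⟨hρ.1.mul_mul_conjTranspose_same _, ?_⟩
    rw [Matrix.trace_mul_cycle, hW, Matrix.one_mul, hρ.2]
  refine le_antisymm
    (Erm_le_of_mem_roofSums hst (mem_roofSums_kronecker_conj hU hV (Erm_mem_roofSums hρ)))
    (Erm_le_of_mem_roofSums hρ ?_)
  -- The reverse inequality comes from applying the inverse local unitaries.
  have h := mem_roofSums_kronecker_conj (Unitary.star_mem hU) (Unitary.star_mem hV) (Erm_mem_roofSums hst)
  rwa [Matrix.star_eq_conjTranspose, Matrix.star_eq_conjTranspose,
    ← Matrix.conjTranspose_kronecker, Matrix.conjTranspose_conjTranspose,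
    show ∀ W : Matrix (Fin m × Fin n) (Fin m × Fin n) ℂ, Wᴴ * (W * ρ * Wᴴ) * W =
      (Wᴴ * W) * ρ * (Wᴴ * W) from fun W => by simp only [Matrix.mul_assoc], hW, Matrix.one_mul,
    Matrix.mul_one] at h

variable {ρ : Matrix (Fin m × Fin n) (Fin m × Fin n) ℂ}

theorem isState_outcomeState {a a' : Type} [Fintype a'] [DecidableEq a'] {G : SuperOp a a'}
    {σ : Matrix a a ℂ} (h : (G σ).PosSemidef) (h0 : outcomeProb G σ ≠ 0) :
    IsState (outcomeState G σ) := by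
  have hp : 0 ≤ outcomeProb G σ := trace_re_nonneg h
  refine ⟨h.smul (inv_nonneg.2 hp), ?_⟩
  have ht : (G σ).trace = (outcomeProb G σ : ℂ) :=
    Complex.ext rfl (Complex.nonneg_iff.1 h.trace_nonneg).2.symm
  rw [outcomeState, Matrix.trace_smul, ht, Complex.real_smul, ← Complex.ofReal_mul,
    inv_mul_cancel₀ h0, Complex.ofReal_one]

theorem sum_outcomeProb_mul_Erm_le (hρ : IsState ρ) {n' K : ℕ}
    {F : Fin K → SuperOp (Fin m × Fin n) (Fin m × Fin n')} (hF : IsLOCC F) :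
    ∑ c, outcomeProb (F c) ρ * Erm (outcomeState (F c) ρ) ≤ Erm ρ := by
  obtain ⟨y, hy, hle⟩ := hF.exists_roofSums m (Erm_mem_roofSums hρ)
  refine (Finset.sum_le_sum fun c _ => ?_).trans hle
  have hpsd := posSemidef_of_mem_roofSums (hy c)
  rcases eq_or_ne (outcomeProb (F c) ρ) 0 with h | h
  -- An outcome of probability zero contributes nothing, whatever `Erm` is on its default normalized
  -- output.
  · rw [h, zero_mul]
    exact nonneg_of_mem_roofSums hρ.left_ne_zero (hy c)
  · have hp : 0 ≤ outcomeProb (F c) ρ := trace_re_nonneg hpsd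
    have := mul_le_mul_of_nonneg_left (Erm_le_of_mem_roofSums (isState_outcomeState hpsd h)
      (smul_mem_roofSums (inv_nonneg.2 hp) (hy c))) hp
    rwa [mul_inv_cancel_left₀ h] at this

theorem trace_sum_onB {m n r : ℕ} {e : Fin r → ℕ} {Φ : ∀ j, SuperOp (Fin n) (Fin (e j))}
    (hΦ : IsInstrument Φ) (X : Matrix (Fin m × Fin n) (Fin m × Fin n) ℂ) :
    ∑ j, (onB (Fin m) (Φ j) X).trace = X.trace := by
  simp only [Matrix.trace, Fintype.sum_prod_type]
  rw [Finset.sum_comm]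
  exact Finset.sum_congr rfl fun s _ => hΦ.2 (Matrix.of fun u v => X (s, u) (s, v))

theorem trace_sum_onA {m n r : ℕ} {e : Fin r → ℕ} {Φ : ∀ j, SuperOp (Fin m) (Fin (e j))}
    (hΦ : IsInstrument Φ) (X : Matrix (Fin m × Fin n) (Fin m × Fin n) ℂ) :
    ∑ j, (onA (Fin n) (Φ j) X).trace = X.trace := by
  simp only [Matrix.trace, Fintype.sum_prod_type_right]
  rw [Finset.sum_comm]
  exact Finset.sum_congr rfl fun s _ => hΦ.2 (Matrix.of fun u v => X (u, s) (v, s))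

theorem IsLOCC.sum_trace {K m n m' n' : ℕ}
    {F : Fin K → SuperOp (Fin m × Fin n) (Fin m' × Fin n')} (hF : IsLOCC F) :
    ∀ X, ∑ c, (F c X).trace = X.trace := by
  induction hF with
  | halt c =>
    intro X
    rw [Finset.sum_eq_single c (fun c' _ h => by simp [h]) (by simp)]
    simp
  | alice Φ F hΦ _ ih =>
    intro X
    rw [← trace_sum_onA hΦ X]
    simp only [LinearMap.sum_apply, Matrix.trace_sum, LinearMap.comp_apply]
    rw [Finset.sum_comm]
    exact Finset.sum_congr rfl fun j _ => ih j _
  | bob Φ F hΦ _ ih =>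
    intro X
    rw [← trace_sum_onB hΦ X]
    simp only [LinearMap.sum_apply, Matrix.trace_sum, LinearMap.comp_apply]
    rw [Finset.sum_comm]
    exact Finset.sum_congr rfl fun j _ => ih j _

/-- The decompositions of all conditional outputs together decompose `Λ ρ`, so normalizing single
outcomes is unnecessary. -/
theorem Erm_map_le (hρ : IsState ρ) {n' : ℕ} {Λ : SuperOp (Fin m × Fin n) (Fin m × Fin n')}
    (hΛ : IsLOCCMap Λ) : Erm (Λ ρ) ≤ Erm ρ := by
  obtain ⟨K, F, hF, rfl⟩ := hΛ
  obtain ⟨y, hy, hle⟩ := hF.exists_roofSums m (Erm_mem_roofSums hρ)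
  have hmem := sum_mem_roofSums m hy
  rw [LinearMap.sum_apply]
  refine (Erm_le_of_mem_roofSums ⟨posSemidef_of_mem_roofSums hmem, ?_⟩ hmem).trans hle
  rw [Matrix.trace_sum, hF.sum_trace, hρ.2]

end Properties

end MomentEntanglement

open MomentEntanglement in
theorem theorem4 (m n : ℕ) :
    -- the minimum over pure state decompositions exists and is the value of the measure
    (∀ ρ : Matrix (Fin m × Fin n) (Fin m × Fin n) ℂ, IsState ρ →
      IsLeast (decompositionValues ρ) (Erm ρ)) ∧
    -- on pure states it is the explicit combination of moments of the reduced state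
    (∀ ψ : Fin m × Fin n → ℂ, IsUnitVec ψ → Erm (ketbra ψ) = pureErm ψ) ∧
    -- nonnegative, and zero on separable states
    (∀ ρ : Matrix (Fin m × Fin n) (Fin m × Fin n) ℂ, IsState ρ → 0 ≤ Erm ρ) ∧
    (∀ ρ : Matrix (Fin m × Fin n) (Fin m × Fin n) ℂ, IsSeparable ρ → Erm ρ = 0) ∧
    -- invariant under local unitaries
    (∀ ρ : Matrix (Fin m × Fin n) (Fin m × Fin n) ℂ, IsState ρ →
      ∀ U ∈ Matrix.unitaryGroup (Fin m) ℂ, ∀ V ∈ Matrix.unitaryGroup (Fin n) ℂ,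
        Erm ((U ⊗ₖ V) * ρ * (U ⊗ₖ V)ᴴ) = Erm ρ) ∧
    -- nonincreasing on average under stochastic LOCC
    (∀ ρ : Matrix (Fin m × Fin n) (Fin m × Fin n) ℂ, IsState ρ →
      ∀ (n' K : ℕ) (F : Fin K → SuperOp (Fin m × Fin n) (Fin m × Fin n')), IsLOCC F →
        ∑ c, outcomeProb (F c) ρ * Erm (outcomeState (F c) ρ) ≤ Erm ρ) ∧
    -- convex
    ConvexOn ℝ {ρ : Matrix (Fin m × Fin n) (Fin m × Fin n) ℂ | IsState ρ} Erm ∧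
    -- nonincreasing under LOCC maps
    (∀ ρ : Matrix (Fin m × Fin n) (Fin m × Fin n) ℂ, IsState ρ →
      ∀ (n' : ℕ) (Λ : SuperOp (Fin m × Fin n) (Fin m × Fin n')), IsLOCCMap Λ →
        Erm (Λ ρ) ≤ Erm ρ) := by
  exact ⟨fun _ hρ => isLeast_Erm hρ, fun _ hψ => Erm_ketbra hψ, fun _ hρ => Erm_nonneg hρ,
    fun _ hρ => Erm_of_isSeparable hρ, fun _ hρ _ hU _ hV => Erm_kronecker_conj hρ hU hV,
    fun _ hρ _ _ _ hF => sum_outcomeProb_mul_Erm_le hρ hF, convexOn_Erm,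
    fun _ hρ _ _ hΛ => Erm_map_le hρ hΛ⟩
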